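/- Let $G$ be a finite abelian group, written additively. For a subset $A\subseteq G$ and an integer $n$ put $A(x)=\sum_{g\in A}x^{g}$ and $A(x^{n})=\sum_{g\in A}x^{n\cdot g}$ in the group algebra $\mathbb Z[G]$, let $A^{(n)}=\{n\cdot g : g\in A\}$, and write $[1]=x^{0}$. A subset $D\subseteq G$ is called a \emph{generalized skew Hadamard difference set} (GSHDS) in $G$ if there are an integer $\lambda$ and an integer $n_0$ whose class modulo the exponent $\exp(G)$ is a unit and a quadratic non-residue (i.e. not a square) in $(\mathbb Z/\exp(G)\mathbb Z)^{*}$, such that, with $k_0=|D\cap D^{(-n_0)}|$, $$D(x)\,D(x^{n_0})=(k_0-\lambda)[1]+\lambda\,G(x),\qquad D(x)+D(x^{n_0})=G(x)-[1].$$ Proposition (Johnsen's exponent bound for GSHDS). Let $p$ be a prime and let $\alpha,s\ge 0$ be integers. Let $G$ be a finite abelian group with $|G|=p^{2\alpha+1}$ and $\exp(G)=p^{s}$. If $G$ admits a GSHDS, then $s\le \alpha+1$. -/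

import Mathlib

namespace GSHDS

/-- For a finite subset `A` of an additive abelian group `G`, the element
`A(x) = ∑_{g ∈ A} x^g` of the integral group algebra `ℤ[G]`. -/
noncomputable def poly {G : Type*} (A : Finset G) : AddMonoidAlgebra ℤ G :=
  ∑ g ∈ A, AddMonoidAlgebra.single g (1 : ℤ)

/-- For `a = ∑ a_g x^g` in `ℤ[G]`, the element `a(x^n) = ∑ a_g x^{n • g}`. -/
noncomputable def powSubst {G : Type*} [AddCommGroup G] (n : ℤ)
    (a : AddMonoidAlgebra ℤ G) : AddMonoidAlgebra ℤ G :=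
  AddMonoidAlgebra.mapDomain (fun g : G => n • g) a

/-- The set `A^{(n)} = {n • g : g ∈ A}`. -/
def multSet {G : Type*} [AddCommGroup G] [DecidableEq G] (n : ℤ) (A : Finset G) : Finset G :=
  A.image (fun g : G => n • g)

/-- `n` represents a quadratic non-residue in the unit group of `ℤ / exp(G) ℤ`, i.e. a unit which
is not the square of a unit. -/
def IsNonResidue (G : Type*) [AddCommGroup G] (n : ℤ) : Prop :=
  ∃ u : (ZMod (AddMonoid.exponent G))ˣ,
    (u : ZMod (AddMonoid.exponent G)) = (n : ZMod (AddMonoid.exponent G)) ∧ ¬ IsSquare u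

/-- A subset `D` of a finite abelian group `G` is a generalized skew Hadamard difference set if,
for some quadratic non-residue `n₀` of `(ℤ / exp(G) ℤ)ˣ` and some integer `lam`, with
`k₀ = |D ∩ D^{(-n₀)}|`, one has in `ℤ[G]`
`D(x) D(x^{n₀}) = (k₀ - lam) [1] + lam G(x)` and `D(x) + D(x^{n₀}) = G(x) - [1]`. -/
def IsGSHDS {G : Type*} [AddCommGroup G] [Fintype G] [DecidableEq G] (D : Finset G) : Prop :=
  ∃ n₀ lam : ℤ, IsNonResidue G n₀ ∧
    poly D * powSubst n₀ (poly D) =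
      (((D ∩ multSet (-n₀) D).card : ℤ) - lam) • (1 : AddMonoidAlgebra ℤ G)
        + lam • poly (Finset.univ : Finset G) ∧
    poly D + powSubst n₀ (poly D) = poly (Finset.univ : Finset G) - 1

end GSHDS

open Polynomial

/-! Write q = p^(2α+1), E = D(x) - D(x^n₀), and let T be a character of order exp G = p^(k+1). Since
T(G) = 0, the defining equations give T(E)² = 1 - 4κ, with κ = k₀ - λ; counting elements turns this
into q(2 - q + 4λ). Hence T(E) = p^α w with w a nonzero algebraic integer. Push E forward to F on
ℤ/p^(k+1). Divisibility of F(ζ) by p^α makes F(x)(x^(p^k) - 1) divisible by p^α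
(`exists_mul_single_sub_one_eq_smul`). Its coefficients have size at most 2p^(2α-k), which is below
p^α once k > α; then the product vanishes, against T(E) ≠ 0 (`GSHDS.le_of_evalRoot_eq`). -/

/-- The dual group is isomorphic to G, so some character has order exp G; its values lie in a cyclic
group of that order and must fill it. -/
theorem exists_surjective_addMonoidHom_zmod_exponent (G : Type*) [AddCommGroup G] [Finite G] :
    ∃ φ : G →+ ZMod (AddMonoid.exponent G), Function.Surjective φ := by
  set n := AddMonoid.exponent G with hn
  have hn0 : NeZero n := ⟨AddMonoid.exponent_ne_zero_of_finite⟩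
  have hexp : Monoid.exponent (Multiplicative G) = n := Monoid.exponent_multiplicative
  have : NeZero (Monoid.exponent (Multiplicative G)) := by rw [hexp]; exact hn0
  obtain ⟨e⟩ := CommGroup.monoidHom_mulEquiv_of_hasEnoughRootsOfUnity (Multiplicative G) ℂ
  have hdual : Monoid.exponent (Multiplicative G →* ℂˣ) = n :=
    (Monoid.exponent_eq_of_mulEquiv e).trans hexp
  obtain ⟨ζ, hζ⟩ : ∃ ζ : ℂˣ, IsPrimitiveRoot ζ n :=
    ⟨_, (Complex.isPrimitiveRoot_exp n hn0.out).isUnit_unit hn0.out⟩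
  let eζ := hζ.zmodEquivZPowers
  have hmem : ∀ (χ : Multiplicative G →* ℂˣ) g, χ g ∈ Subgroup.zpowers ζ := by
    intro χ g
    rw [hζ.zpowers_eq, mem_rootsOfUnity, ← map_pow, ← hexp, Monoid.pow_exponent_eq_one, map_one]
  have : Finite (Multiplicative G →* ℂˣ) := Finite.of_equiv _ e.symm.toEquiv
  obtain ⟨χ, hχ⟩ := Monoid.exists_orderOf_eq_exponent
    (Monoid.ExponentExists.of_finite (G := Multiplicative G →* ℂˣ))
  rw [hdual] at hχ
  let φ : G →+ ZMod n := (eζ.symm : _ →+ ZMod n).comp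
    (MonoidHom.toAdditive (χ.codRestrict (Subgroup.zpowers ζ) (hmem χ)) : G →+ _)
  have hφ : ∀ (m : ℕ) g, m • φ g = 0 → χ (Multiplicative.ofAdd g) ^ m = 1 := by
    intro m g h
    rw [← map_nsmul] at h
    have h2 := (map_eq_zero_iff _ eζ.symm.injective).1 h
    have h3 : χ (Multiplicative.ofAdd (m • g)) = 1 :=
      congrArg (fun x => ((Additive.toMul x : Subgroup.zpowers ζ) : ℂˣ)) h2
    rwa [ofAdd_nsmul, map_pow] at h3
  refine ⟨φ, ?_⟩
  have hr : AddMonoid.exponent φ.range = n := by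
    refine Nat.dvd_antisymm ?_ ?_
    · refine AddMonoid.exponent_dvd_of_forall_nsmul_eq_zero fun x => Subtype.ext ?_
      simp
    · refine hχ.symm.dvd.trans ?_
      refine orderOf_dvd_of_pow_eq_one (MonoidHom.ext fun g => ?_)
      refine hφ _ (Multiplicative.toAdd g) ?_
      exact congrArg Subtype.val
        (AddMonoid.exponent_nsmul_eq_zero (⟨φ (Multiplicative.toAdd g), _, rfl⟩ : φ.range))
  have hd : n ∣ Nat.card φ.range := by
    conv_lhs => rw [← hr]
    exact AddGroup.exponent_dvd_nat_card
  rw [← AddMonoidHom.range_eq_top]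
  refine AddSubgroup.eq_top_of_le_card _ ?_
  rw [Nat.card_zmod]
  exact Nat.le_of_dvd Nat.card_pos hd

/-! ### Divisibility in the group ring of a cyclic p-group -/

/-- The ring homomorphism `ℤ[ℤ/n] → K` sending the generator to an `n`-th root of unity `ζ`. -/
noncomputable def evalRoot {K : Type*} [Field K] {n : ℕ} [NeZero n] {ζ : K} (hζ : ζ ^ n = 1) :
    AddMonoidAlgebra ℤ (ZMod n) →ₐ[ℤ] K :=
  AddMonoidAlgebra.lift ℤ K (ZMod n) (AddChar.zmodChar n hζ).toMonoidHom

theorem evalRoot_single {K : Type*} [Field K] {n : ℕ} [NeZero n] {ζ : K} (hζ : ζ ^ n = 1)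
    (a : ZMod n) (c : ℤ) :
    evalRoot hζ (AddMonoidAlgebra.single a c) = c * AddChar.zmodChar n hζ a := by
  simp [evalRoot, AddMonoidAlgebra.lift_single]

theorem AddMonoidAlgebra.aeval_single_surjective (n : ℕ) [NeZero n] :
    Function.Surjective (aeval (R := ℤ)
      (AddMonoidAlgebra.single (1 : ZMod n) (1 : ℤ))) := by
  intro F
  induction F using AddMonoidAlgebra.induction_on with
  | of m =>
    refine ⟨X ^ m.val, ?_⟩
    simp [AddMonoidAlgebra.single_pow]
  | add x y hx hy =>
    obtain ⟨f, rfl⟩ := hx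
    obtain ⟨g, rfl⟩ := hy
    exact ⟨f + g, map_add _ _ _⟩
  | smul r x hx =>
    obtain ⟨f, rfl⟩ := hx
    exact ⟨r • f, map_smul _ _ _⟩

/-- If the value of `F ∈ ℤ[ℤ/p^(k+1)]` at a primitive root of unity is divisible by `m` in the
ring of algebraic integers, then `F` is divisible by `m` up to the difference of two translates
by the subgroup of order `p`. -/
theorem exists_mul_single_sub_one_eq_smul {K : Type*} [Field K] [CharZero K] {p k : ℕ}
    [hp : Fact p.Prime] [IsCyclotomicExtension {p ^ (k + 1)} ℚ K] {ζ : K}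
    (hζ : IsPrimitiveRoot ζ (p ^ (k + 1))) (m : ℤ) (F : AddMonoidAlgebra ℤ (ZMod (p ^ (k + 1))))
    (w : K) (hw : IsIntegral ℤ w) (hF : evalRoot hζ.pow_eq_one F = m * w) :
    ∃ W : AddMonoidAlgebra ℤ (ZMod (p ^ (k + 1))),
      F * (AddMonoidAlgebra.single ((p ^ k : ℕ) : ZMod (p ^ (k + 1))) 1 - 1) = m • W := by
  set x : AddMonoidAlgebra ℤ (ZMod (p ^ (k + 1))) := AddMonoidAlgebra.single 1 1 with hx
  have hpk : 1 < p ^ (k + 1) := Nat.one_lt_pow (by omega) hp.out.one_lt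
  have hxζ : evalRoot hζ.pow_eq_one x = ζ := by
    have : Fact (1 < p ^ (k + 1)) := ⟨hpk⟩
    rw [evalRoot_single, AddChar.zmodChar_apply, ZMod.val_one]
    simp
  have hev : ∀ f : ℤ[X], evalRoot hζ.pow_eq_one (aeval x f) = aeval ζ f := by
    intro f
    rw [← Polynomial.aeval_algHom_apply, hxζ]
  have hxpow : ∀ j : ℕ, x ^ j = AddMonoidAlgebra.single (j : ZMod (p ^ (k + 1))) 1 := by
    intro j
    simp [hx, AddMonoidAlgebra.single_pow]
  obtain ⟨f, hf⟩ := AddMonoidAlgebra.aeval_single_surjective (p ^ (k + 1)) F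
  -- The ring of integers is ℤ[ζ], so w = v(ζ) for an integer polynomial v, and f - m v is a
  -- multiple of the cyclotomic polynomial.
  have hint := IsCyclotomicExtension.Rat.isIntegralClosure_adjoin_singleton_of_prime_pow hζ
  obtain ⟨⟨w', hw'⟩, rfl⟩ := hint.isIntegral_iff.1 hw
  rw [Algebra.adjoin_singleton_eq_range_aeval] at hw'
  obtain ⟨v, rfl⟩ := hw'
  have h0 : aeval ζ (f - C m * v) = 0 := by
    rw [map_sub, map_mul, ← hev f, hf, hF, aeval_C]
    simp
  have hdvd := minpoly.isIntegrallyClosed_dvd (hζ.isIntegral (by omega)) h0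
  rw [← cyclotomic_eq_minpoly hζ (by omega)] at hdvd
  obtain ⟨g, hg⟩ := hdvd
  have hkill : aeval x (cyclotomic (p ^ (k + 1)) ℤ) *
      (AddMonoidAlgebra.single ((p ^ k : ℕ) : ZMod (p ^ (k + 1))) 1 - 1) = 0 := by
    have := congrArg (aeval x) (cyclotomic_prime_pow_mul_X_pow_sub_one ℤ p k)
    rw [map_mul, map_sub, map_sub, map_pow, map_pow, aeval_X, map_one, hxpow, hxpow,
      ZMod.natCast_self, ← AddMonoidAlgebra.one_def, sub_self] at this
    exact this
  refine ⟨aeval x v * (AddMonoidAlgebra.single ((p ^ k : ℕ) : ZMod (p ^ (k + 1))) 1 - 1), ?_⟩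
  have hFe : F = m • aeval x v + aeval x (cyclotomic (p ^ (k + 1)) ℤ) * aeval x g := by
    rw [← hf, ← map_mul, ← hg, map_sub, map_mul, aeval_C, ← Algebra.smul_def]
    abel
  rw [hFe, add_mul, mul_right_comm, hkill, zero_mul, add_zero, smul_mul_assoc]

/-! ### Coefficient bounds from fibre sizes -/

theorem AddMonoidAlgebra.coeff_mapDomain_eq_sum_fiber {R G H : Type*} [Semiring R] [Fintype G]
    [DecidableEq H] (φ : G → H) (E : AddMonoidAlgebra R G) (a : H) :
    (AddMonoidAlgebra.mapDomain φ E).coeff a = ∑ g with φ g = a, E.coeff g := by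
  induction E using AddMonoidAlgebra.induction_linear with
  | zero => simp
  | add x y hx hy =>
    rw [AddMonoidAlgebra.mapDomain_add, AddMonoidAlgebra.coeff_add,
      Finsupp.add_apply, hx, hy, ← Finset.sum_add_distrib]
    simp
  | single m r =>
    classical
    simp [AddMonoidAlgebra.coeff_single, Finsupp.single_apply, Finset.sum_ite_eq]

theorem AddMonoidHom.card_fiber_mul_card {G H : Type*} [AddGroup G] [Fintype G] [AddGroup H]
    [Fintype H] [DecidableEq H] (φ : G →+ H) (hφ : Function.Surjective φ) (a : H) :
    Finset.card {g | φ g = a} * Fintype.card H = Fintype.card G := by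
  rw [← Finset.card_univ (α := G), Finset.card_eq_sum_card_fiberwise (s := (Finset.univ : Finset G))
    (f := φ) (t := Finset.univ) (by simp), Finset.sum_congr rfl fun b _ =>
      AddMonoidHom.card_fiber_eq_of_mem_range φ (hφ b) (hφ a)]
  simp [mul_comm]

/-- An element of the group ring with coefficients in `{-1, 0, 1}` whose image under a character of
order `exp G` is nonzero and divisible by `p ^ α` bounds the exponent of `G`. -/
theorem GSHDS.le_of_evalRoot_eq {G : Type*} [AddCommGroup G] [Fintype G]
    {K : Type*} [Field K] [CharZero K] {p α k : ℕ} [hp : Fact p.Prime] (hp2 : p ≠ 2)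
    [IsCyclotomicExtension {p ^ (k + 1)} ℚ K] {ζ : K} (hζ : IsPrimitiveRoot ζ (p ^ (k + 1)))
    (hcard : Fintype.card G = p ^ (2 * α + 1))
    (φ : G →+ ZMod (p ^ (k + 1))) (hφ : Function.Surjective φ)
    (E : AddMonoidAlgebra ℤ G) (hE : ∀ g, |E.coeff g| ≤ 1) (w : K) (hw : IsIntegral ℤ w)
    (hw0 : w ≠ 0)
    (hEw : evalRoot hζ.pow_eq_one (AddMonoidAlgebra.mapDomainRingHom ℤ φ E) =
      ((p ^ α : ℕ) : ℤ) * w) :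
    k ≤ α := by
  by_contra! hk
  set F := AddMonoidAlgebra.mapDomainRingHom ℤ φ E with hFdef
  set h : ZMod (p ^ (k + 1)) := ((p ^ k : ℕ) : ZMod (p ^ (k + 1))) with hh
  obtain ⟨W, hW⟩ := exists_mul_single_sub_one_eq_smul hζ _ F w hw hEw
  have hFc : ∀ a, |F.coeff a| * (p ^ (k + 1) : ℕ) ≤ (p ^ (2 * α + 1) : ℕ) := by
    intro a
    have h1 : |F.coeff a| ≤ (Finset.card {g | φ g = a} : ℕ) := by
      rw [hFdef, AddMonoidAlgebra.mapDomainRingHom_apply,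
        AddMonoidAlgebra.coeff_mapDomain_eq_sum_fiber]
      refine (Finset.abs_sum_le_sum_abs _ _).trans ?_
      refine (Finset.sum_le_sum fun g _ => hE g).trans ?_
      simp
    have h2 := AddMonoidHom.card_fiber_mul_card φ hφ a
    rw [ZMod.card, hcard] at h2
    rw [← h2, Nat.cast_mul]
    exact mul_le_mul_of_nonneg_right h1 (by positivity)
  have hp3 : 3 ≤ p := by have := hp.out.two_le; omega
  -- Stated after multiplying by p^(k+1), which avoids the possibly negative exponent 2α - k; p ≥ 3
  -- absorbs the factor 2.
  have hpow : 2 * p ^ (2 * α + 1) < p ^ α * p ^ (k + 1) := by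
    calc 2 * p ^ (2 * α + 1) < p * p ^ (2 * α + 1) := by
          exact Nat.mul_lt_mul_of_pos_right (by omega) (pow_pos hp.out.pos _)
      _ = p ^ (2 * α + 2) := by ring
      _ ≤ p ^ (α + (k + 1)) := Nat.pow_le_pow_right hp.out.pos (by omega)
      _ = p ^ α * p ^ (k + 1) := pow_add _ _ _
  have hY : F * (AddMonoidAlgebra.single h 1 - 1) = 0 := by
    ext a
    have hcoef : (F * (AddMonoidAlgebra.single h 1 - 1)).coeff a = F.coeff (a - h) - F.coeff a := by
      have := AddMonoidAlgebra.coeff_mul_single_add F (1 : ℤ) h (a - h)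
      rw [sub_add_cancel, mul_one] at this
      rw [mul_sub, mul_one, AddMonoidAlgebra.coeff_sub, Finsupp.sub_apply, this]
    have hdvd : ((p ^ α : ℕ) : ℤ) ∣ (F * (AddMonoidAlgebra.single h 1 - 1)).coeff a := by
      rw [hW]
      exact ⟨W.coeff a, by rw [AddMonoidAlgebra.coeff_smul, Finsupp.smul_apply, smul_eq_mul]⟩
    refine Int.eq_zero_of_abs_lt_dvd hdvd ?_
    rw [hcoef]
    have hpos : (0 : ℤ) < (p ^ (k + 1) : ℕ) := by exact_mod_cast pow_pos hp.out.pos _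
    refine lt_of_mul_lt_mul_right ?_ hpos.le
    calc |F.coeff (a - h) - F.coeff a| * (p ^ (k + 1) : ℕ)
        ≤ (|F.coeff (a - h)| + |F.coeff a|) * (p ^ (k + 1) : ℕ) :=
          mul_le_mul_of_nonneg_right (abs_sub _ _) hpos.le
      _ ≤ 2 * (p ^ (2 * α + 1) : ℕ) := by linarith [hFc (a - h), hFc a]
      _ < (p ^ α : ℕ) * (p ^ (k + 1) : ℕ) := by exact_mod_cast hpow
  have hval := congrArg (evalRoot hζ.pow_eq_one) hY
  rw [map_mul, hEw, map_sub, map_one, map_zero, evalRoot_single, hh, AddChar.zmodChar_apply'] at hval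
  have hne : ζ ^ p ^ k ≠ 1 :=
    hζ.pow_ne_one_of_pos_of_lt (pow_ne_zero _ hp.out.ne_zero)
      (Nat.pow_lt_pow_right hp.out.one_lt (by omega))
  have hpK : (((p ^ α : ℕ) : ℤ) : K) ≠ 0 := by
    exact_mod_cast pow_ne_zero _ hp.out.ne_zero
  simp only [Int.cast_one, one_mul] at hval
  exact mul_ne_zero (mul_ne_zero hpK hw0) (sub_ne_zero.2 hne) hval

/-! ### Character values of a GSHDS -/

theorem GSHDS.coeff_poly {G : Type*} [DecidableEq G] (A : Finset G) (g : G) :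
    (GSHDS.poly A).coeff g = if g ∈ A then 1 else 0 := by
  simp [GSHDS.poly, AddMonoidAlgebra.coeff_sum, Finsupp.finsetSum_apply, AddMonoidAlgebra.coeff_single,
    Finsupp.single_apply]

theorem GSHDS.powSubst_poly {G : Type*} [AddCommGroup G] (n : ℤ) (A : Finset G) :
    GSHDS.powSubst n (GSHDS.poly A) = ∑ g ∈ A, AddMonoidAlgebra.single (n • g) (1 : ℤ) := by
  have := map_sum (AddMonoidAlgebra.mapDomainRingHom ℤ (zsmulAddGroupHom n : G →+ G))
    (fun g => AddMonoidAlgebra.single g (1 : ℤ)) A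
  simp only [AddMonoidAlgebra.mapDomainRingHom_apply, AddMonoidAlgebra.mapDomain_single] at this
  exact this

/-- The difference `D(x) - D(x^n)` has coefficients in `{-1, 0, 1}` if `D(x) + D(x^n) = G(x) - 1`. -/
theorem GSHDS.abs_coeff_sub_powSubst_le {G : Type*} [AddCommGroup G] [Fintype G] [DecidableEq G]
    {D : Finset G} {n : ℤ}
    (h : GSHDS.poly D + GSHDS.powSubst n (GSHDS.poly D) =
      GSHDS.poly (Finset.univ : Finset G) - 1) (g : G) :
    |(GSHDS.poly D - GSHDS.powSubst n (GSHDS.poly D)).coeff g| ≤ 1 := by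
  have h1 := congrArg (fun a => a.coeff g) h
  have h2 : 0 ≤ (GSHDS.powSubst n (GSHDS.poly D)).coeff g := by
    rw [GSHDS.powSubst_poly, AddMonoidAlgebra.coeff_sum, Finsupp.finsetSum_apply]
    refine Finset.sum_nonneg fun x _ => ?_
    rw [AddMonoidAlgebra.coeff_single, Finsupp.single_apply]
    split_ifs <;> simp
  have h3 : 0 ≤ (GSHDS.poly D).coeff g := by
    rw [GSHDS.coeff_poly]
    split_ifs <;> simp
  have h4 : (0 : ℤ) ≤ (1 : AddMonoidAlgebra ℤ G).coeff g := by
    rw [AddMonoidAlgebra.one_def, AddMonoidAlgebra.coeff_single, Finsupp.single_apply]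
    split_ifs <;> simp
  simp only [AddMonoidAlgebra.coeff_add, AddMonoidAlgebra.coeff_sub, Finsupp.add_apply,
    Finsupp.sub_apply, GSHDS.coeff_poly Finset.univ, Finset.mem_univ, if_true] at h1 ⊢
  rw [abs_le]
  constructor <;> linarith

theorem GSHDS.exponent_le_of_isCyclotomicExtension {G : Type*} [AddCommGroup G] [Fintype G]
    [DecidableEq G]
    (K : Type*) [Field K] [CharZero K] (p : ℕ) (hp : p.Prime) (α k : ℕ)
    [IsCyclotomicExtension {p ^ (k + 1)} ℚ K]
    (hcard : Fintype.card G = p ^ (2 * α + 1))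
    (hexp : AddMonoid.exponent G = p ^ (k + 1))
    (D : Finset G) (hD : GSHDS.IsGSHDS D) :
    k ≤ α := by
  obtain ⟨n, lam, -, hmul, hadd⟩ := hD
  generalize (((D ∩ GSHDS.multSet (-n) D).card : ℤ) - lam) = κ at hmul
  have : Fact p.Prime := ⟨hp⟩
  let ε : AddMonoidAlgebra ℤ G →ₐ[ℤ] ℤ := AddMonoidAlgebra.lift ℤ ℤ G 1
  have hεD : ∀ A : Finset G, ε (GSHDS.poly A) = A.card := fun A => by
    simp [ε, GSHDS.poly]
  have hεD' : ε (GSHDS.powSubst n (GSHDS.poly D)) = D.card := by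
    simp [ε, GSHDS.powSubst_poly]
  have hsum : 2 * (D.card : ℤ) = (p : ℤ) ^ (2 * α + 1) - 1 := by
    have := congrArg ε hadd
    rw [map_add, map_sub, map_one, hεD, hεD, hεD', Finset.card_univ, hcard] at this
    push_cast at this
    linarith
  have hprod : (D.card : ℤ) * D.card = κ + lam * (p : ℤ) ^ (2 * α + 1) := by
    have := congrArg ε hmul
    rw [map_mul, map_add, map_zsmul, map_zsmul, map_one, hεD, hεD, hεD', Finset.card_univ,
      hcard] at this
    push_cast at this
    simpa using this
  -- For p = 2 the right side of `hsum` would be odd.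
  have hp2 : p ≠ 2 := by
    rintro rfl
    rw [pow_succ] at hsum
    push_cast at hsum
    omega
  have hodd : Odd ((p : ℤ) ^ (2 * α + 1)) :=
    Odd.pow (by exact_mod_cast hp.odd_of_ne_two hp2)
  set q : ℤ := (p : ℤ) ^ (2 * α + 1) with hq
  -- The left side is the discriminant of t² + t + κ, whose roots are T(D(x)) and T(D(x^n₀)).
  have hdisc : 1 - 4 * κ = q * (2 - q + 4 * lam) := by
    linear_combination 4 * hprod - (2 * (D.card : ℤ) + q - 1) * hsum
  -- It is odd, because q is.
  have hm0 : 2 - q + 4 * lam ≠ 0 := by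
    obtain ⟨r, hr⟩ := hodd
    omega
  have : NeZero (p ^ (k + 1)) := ⟨pow_ne_zero _ hp.ne_zero⟩
  have hζ : IsPrimitiveRoot (IsCyclotomicExtension.zeta (p ^ (k + 1)) ℚ K) (p ^ (k + 1)) :=
    IsCyclotomicExtension.zeta_spec _ _ _
  obtain ⟨φ, hφ⟩ : ∃ φ : G →+ ZMod (p ^ (k + 1)), Function.Surjective φ := by
    rw [← hexp]
    exact exists_surjective_addMonoidHom_zmod_exponent G
  let T : AddMonoidAlgebra ℤ G →+* K :=
    (evalRoot hζ.pow_eq_one).toRingHom.comp (AddMonoidAlgebra.mapDomainRingHom ℤ φ)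
  have hTU : T (GSHDS.poly Finset.univ) = 0 := by
    have hψ : (AddChar.zmodChar _ hζ.pow_eq_one).compAddMonoidHom φ ≠ 1 := by
      intro h
      obtain ⟨g, hg⟩ := hφ ((1 : ℕ) : ZMod (p ^ (k + 1)))
      have h1 := DFunLike.congr_fun h g
      rw [AddChar.compAddMonoidHom_apply, hg, AddChar.zmodChar_apply', pow_one,
        AddChar.one_apply] at h1
      exact hζ.ne_one (Nat.one_lt_pow (by omega) hp.one_lt) h1
    rw [← AddChar.sum_eq_zero_of_ne_one hψ]
    simp [T, GSHDS.poly, evalRoot_single]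
  have hTadd := congrArg T hadd
  have hTmul := congrArg T hmul
  simp only [map_add, map_mul, map_sub, map_one, map_zsmul, hTU] at hTadd hTmul
  have hsq : T (GSHDS.poly D - GSHDS.powSubst n (GSHDS.poly D)) ^ 2 =
      (p : K) ^ (2 * α + 1) * ((2 - q + 4 * lam : ℤ) : K) := by
    have hd : (1 : K) - 4 * (κ : K) = (p : K) ^ (2 * α + 1) * ((2 - q + 4 * lam : ℤ) : K) := by
      have := congrArg (Int.cast : ℤ → K) hdisc
      rw [hq] at this ⊢
      push_cast at this ⊢
      exact this
    rw [← hd, map_sub]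
    rw [zsmul_eq_mul, smul_zero, mul_one, add_zero] at hTmul
    linear_combination (T (GSHDS.poly D) + T (GSHDS.powSubst n (GSHDS.poly D)) - 1) * hTadd
      - 4 * hTmul
  have hpK : (p : K) ≠ 0 := by exact_mod_cast hp.ne_zero
  set w : K := T (GSHDS.poly D - GSHDS.powSubst n (GSHDS.poly D)) / (p : K) ^ α with hw
  have hw2 : w ^ 2 = ((p * (2 - q + 4 * lam) : ℤ) : K) := by
    rw [hw, div_pow, hsq, div_eq_iff (pow_ne_zero _ (pow_ne_zero _ hpK))]
    push_cast
    ring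
  have hwint : IsIntegral ℤ w := by
    refine IsIntegral.of_pow two_pos ?_
    rw [hw2]
    exact isIntegral_algebraMap (R := ℤ) (A := K)
  have hw0 : w ≠ 0 := by
    intro h
    rw [h, zero_pow two_ne_zero, eq_comm, Int.cast_eq_zero] at hw2
    exact mul_ne_zero (by exact_mod_cast hp.ne_zero) hm0 hw2
  have hTE : T (GSHDS.poly D - GSHDS.powSubst n (GSHDS.poly D)) = ((p ^ α : ℕ) : ℤ) * w := by
    rw [hw]
    push_cast
    rw [mul_div_cancel₀ _ (pow_ne_zero _ hpK)]
  exact GSHDS.le_of_evalRoot_eq hp2 hζ hcard φ hφ _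
    (GSHDS.abs_coeff_sub_powSubst_le hadd) w hwint hw0 hTE

theorem mainTheorem2 {G : Type*} [AddCommGroup G] [Fintype G] [DecidableEq G]
    (p : ℕ) (hp : p.Prime) (α s : ℕ)
    (hcard : Fintype.card G = p ^ (2 * α + 1))
    (hexp : AddMonoid.exponent G = p ^ s)
    (D : Finset G) (hD : GSHDS.IsGSHDS D) :
    s ≤ α + 1 := by
  rcases s with _ | k
  · exact Nat.zero_le _
  · have : NeZero (p ^ (k + 1)) := ⟨pow_ne_zero _ hp.ne_zero⟩
    -- The field carries two ℚ-algebra structures, equal by uniqueness.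
    have : @IsCyclotomicExtension {p ^ (k + 1)} ℚ (CyclotomicField (p ^ (k + 1)) ℚ) _ _
        DivisionRing.toRatAlgebra := by
      rw [Subsingleton.elim (DivisionRing.toRatAlgebra (R := CyclotomicField (p ^ (k + 1)) ℚ))
        (CyclotomicField.algebra (p ^ (k + 1)) ℚ)]
      exact CyclotomicField.isCyclotomicExtension (p ^ (k + 1)) ℚ
    exact Nat.succ_le_succ (GSHDS.exponent_le_of_isCyclotomicExtension
      (CyclotomicField (p ^ (k + 1)) ℚ) p hp α k hcard hexp D hD)
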